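/- Conventions. A complete orientable hyperbolic 3-manifold is a quotient $N=\mathbb H^3/\Gamma$, where $\Gamma$ is a group of orientation-preserving isometries of $\mathbb H^3$ acting freely and properly discontinuously. Let $\Omega_\Gamma\subset S^2_\infty$ be the largest open subset of the sphere at infinity on which $\Gamma$ acts discontinuously, let $L_\Gamma=S^2_\infty\setminus\Omega_\Gamma$ be the limit set, and let $d(N)$ be the Hausdorff dimension of $L_\Gamma$. Let $\lambda_0(N)$ be the largest $\lambda$ (the supremum of all real $\lambda$) for which there is a positive $C^\infty$ function $f$ on $N$ with $\Delta f+\lambda f=0$, where $\Delta=\operatorname{div}\circ\operatorname{grad}$. A compact, orientable 3-manifold $M$ (possibly with boundary) is hyperbolizable if its interior is homeomorphic to some such $N$. For such an $M$ let $TT(M)$ be the set of all complete orientable hyperbolic 3-manifolds $N$ homeomorphic to the interior of $M$, and put $$D(M)=\inf\{d(N)\mid N\in TT(M)\},\qquad \Lambda(M)=\sup\{\lambda_0(N)\mid N\in TT(M)\}.$$ **Proposition 2.6.** Let $M$ and $M'$ be compact, orientable, hyperbolizable 3-manifolds such that the interior of $M'$ covers the interior of $M$ (that is, there is a surjective topological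 covering map $\operatorname{int}(M')\to\operatorname{int}(M)$). Then $$D(M)\ge D(M')\qquad\text{and}\qquad \Lambda(M)\le\Lambda(M').$$ -/

import Mathlib

open scoped Manifold ContDiff ENNReal

noncomputable section

namespace HypThree

/-! ### Hyperbolic 3-space: the hyperboloid model -/

/-- Euclidean 3-space. -/
abbrev E3 : Type := EuclideanSpace ℝ (Fin 3)

/-- Minkowski space `ℝ^{1,3}`; the first factor is the time coordinate. -/
abbrev Mink : Type := ℝ × E3

/-- The Lorentz quadratic form `-t² + |y|²`. -/
def lorentz (x : Mink) : ℝ := -x.1 ^ 2 + ‖x.2‖ ^ 2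

/-- The upper sheet of the hyperboloid `-t² + |y|² = -1`. -/
def sheet : Set Mink := {x | lorentz x = -1 ∧ 0 < x.1}

/-- Hyperbolic 3-space, with the subspace topology. -/
abbrev Hyp3 : Type := sheet

theorem lorentz_neg (x : Mink) : lorentz (-x) = lorentz x := by
  simp [lorentz]

theorem mem_sheet_or_neg {x : Mink} (h : lorentz x = -1) : x ∈ sheet ∨ -x ∈ sheet := by
  have hne : x.1 ≠ 0 := by
    intro h0
    have := sq_nonneg ‖x.2‖
    simp only [lorentz, h0] at h
    linarith
  rcases lt_or_gt_of_ne hne with hlt | hgt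
  · right
    exact ⟨by rw [lorentz_neg, h], by simpa using hlt⟩
  · left
    exact ⟨h, hgt⟩

/-- The group `SO⁺(1,3)` of orientation-preserving isometries of hyperbolic 3-space: linear
automorphisms of Minkowski space of determinant one which preserve the Lorentz form and the
upper sheet of the hyperboloid. -/
def IsomPlus : Subgroup (Mink ≃ₗ[ℝ] Mink) where
  carrier := {g | (∀ x, lorentz (g x) = lorentz x) ∧ (∀ x ∈ sheet, g x ∈ sheet) ∧
    LinearMap.det (g : Mink →ₗ[ℝ] Mink) = 1}
  one_mem' := by
    refine ⟨fun x => rfl, fun x hx => hx, ?_⟩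
    exact LinearMap.det_id
  mul_mem' := by
    rintro a b ⟨ha1, ha2, ha3⟩ ⟨hb1, hb2, hb3⟩
    refine ⟨fun x => ?_, fun x hx => ha2 _ (hb2 x hx), ?_⟩
    · change lorentz (a (b x)) = _
      rw [ha1, hb1]
    · change LinearMap.det ((a : Mink →ₗ[ℝ] Mink) * (b : Mink →ₗ[ℝ] Mink)) = 1
      rw [map_mul, ha3, hb3, one_mul]
  inv_mem' := by
    rintro a ⟨ha1, ha2, ha3⟩
    have hinv : ∀ x, a (a⁻¹ x) = x := fun x => a.apply_symm_apply x
    have hq : ∀ x, lorentz (a⁻¹ x) = lorentz x := fun x => by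
      conv_rhs => rw [← hinv x]
      rw [ha1]
    refine ⟨hq, fun x hx => ?_, ?_⟩
    · rcases mem_sheet_or_neg ((hq x).trans hx.1) with h | h
      · exact h
      · exfalso
        have h2 := (ha2 _ h).2
        rw [map_neg, hinv] at h2
        have h3 := hx.2
        simp only [Prod.fst_neg] at h2
        linarith
    · change LinearMap.det (a.symm : Mink →ₗ[ℝ] Mink) = 1
      have h := LinearEquiv.det_symm_mul_det a
      rwa [ha3, mul_one] at h

/-- The action of isometries on hyperbolic 3-space. -/
instance : MulAction IsomPlus Hyp3 where
  smul g x := ⟨g.1 x.1, g.2.2.1 x.1 x.2⟩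
  one_smul _ := rfl
  mul_smul _ _ _ := rfl

/-! ### The sphere at infinity -/

/-- The sphere at infinity, the round unit sphere of Euclidean 3-space. The point `ξ` stands for
the light ray through `(1, ξ)`, which is an end of the hyperboloid. -/
abbrev SphereInf : Type := Metric.sphere (0 : E3) 1

theorem bdry_aux (g : IsomPlus) (ξ : SphereInf) :
    (g.1 (1, ξ.1)).1⁻¹ • (g.1 (1, ξ.1)).2 ∈ Metric.sphere (0 : E3) 1 := by
  have hξ : ‖ξ.1‖ = 1 := by simp
  have h := g.2.1 (1, ξ.1)
  have hne : g.1 (1, ξ.1) ≠ 0 := by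
    rw [Ne, LinearEquiv.map_eq_zero_iff, Prod.ext_iff]
    simp
  generalize g.1 (1, ξ.1) = z at h hne
  obtain ⟨s, w⟩ := z
  simp only [lorentz, hξ] at h
  have hs : s ≠ 0 := by
    rintro rfl
    apply hne
    have : ‖w‖ = 0 := by
      have : ‖w‖ ^ 2 = 0 := by linarith
      simpa using this
    simp [norm_eq_zero.mp this]
  have habs : ‖w‖ = |s| := by
    rw [← abs_of_nonneg (norm_nonneg w)]
    exact (sq_eq_sq_iff_abs_eq_abs _ _).mp (by linarith)
  simp [norm_smul, habs, hs]

/-- The conformal map of the sphere at infinity by which an isometry extends: the linear map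
acts on the light rays. -/
def bdryMap (g : IsomPlus) (ξ : SphereInf) : SphereInf :=
  ⟨(g.1 (1, ξ.1)).1⁻¹ • (g.1 (1, ξ.1)).2, bdry_aux g ξ⟩

/-- The group `Γ` acts discontinuously on the set `U`: every point of `U` has a neighbourhood `V`
which meets only finitely many of its translates (counted by group elements). -/
def ActsDiscontinuouslyOn (Γ : Subgroup IsomPlus) (U : Set SphereInf) : Prop :=
  ∀ ξ ∈ U, ∃ V ∈ nhds ξ, {γ : IsomPlus | γ ∈ Γ ∧ (bdryMap γ '' V ∩ V).Nonempty}.Finite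

/-- The domain of discontinuity: the largest open set on which `Γ` acts discontinuously, which is
the union of all such open sets. -/
def domainOfDiscontinuity (Γ : Subgroup IsomPlus) : Set SphereInf :=
  ⋃₀ {U | IsOpen U ∧ ActsDiscontinuouslyOn Γ U}

/-- The limit set. -/
def limitSet (Γ : Subgroup IsomPlus) : Set SphereInf := (domainOfDiscontinuity Γ)ᶜ

/-! ### Hyperbolic 3-manifolds and their invariants -/

/-- `Γ` acts freely and properly discontinuously on hyperbolic 3-space, equivalently `Γ` is
discrete and torsion-free. The complete orientable hyperbolic 3-manifolds are the quotients of
hyperbolic 3-space by these groups. -/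
structure IsTorsionFreeKleinian (Γ : Subgroup IsomPlus) : Prop where
  free : ∀ γ ∈ Γ, ∀ x : Hyp3, γ • x = x → γ = 1
  properlyDiscontinuous : ∀ K : Set Hyp3, IsCompact K →
    {γ : IsomPlus | γ ∈ Γ ∧ ((fun x : Hyp3 => γ • x) '' K ∩ K).Nonempty}.Finite

/-- The hyperbolic 3-manifold `N = ℍ³ / Γ`, with the quotient topology. -/
abbrev HypQuotient (Γ : Subgroup IsomPlus) : Type := MulAction.orbitRel.Quotient Γ Hyp3

/-- The quotient map `ℍ³ → ℍ³ / Γ`. -/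
def proj (Γ : Subgroup IsomPlus) (x : Hyp3) : HypQuotient Γ :=
  Quotient.mk (MulAction.orbitRel Γ Hyp3) x

/-- `d(N)`, the Hausdorff dimension of the limit set of `Γ` in the round sphere. -/
def hdim (Γ : Subgroup IsomPlus) : ℝ≥0∞ := dimH (limitSet Γ)

theorem graph_mem_sheet (y : E3) : ((Real.sqrt (1 + ‖y‖ ^ 2), y) : Mink) ∈ sheet := by
  have h : (0 : ℝ) < 1 + ‖y‖ ^ 2 := by positivity
  refine ⟨?_, Real.sqrt_pos.mpr h⟩
  simp only [lorentz, Real.sq_sqrt h.le]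
  ring

/-- The global coordinates `y ↦ (√(1 + |y|²), y)` of the hyperboloid. -/
def graphParam (y : E3) : Hyp3 := ⟨(Real.sqrt (1 + ‖y‖ ^ 2), y), graph_mem_sheet y⟩

/-- The hyperbolic metric in these coordinates: the restriction `-dt² + |dy|²` of the Lorentz form
to the hyperboloid, where `dt = ⟪y, dy⟫ / √(1 + |y|²)`. -/
def hypMetric (y v w : E3) : ℝ := inner ℝ v w - inner ℝ y v * inner ℝ y w / (1 + ‖y‖ ^ 2)

/-- The gradient for the hyperbolic metric (see `hypMetric_hypGrad`). -/
def hypGrad (u : E3 → ℝ) (y : E3) : E3 := gradient u y + inner ℝ y (gradient u y) • y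

theorem hypMetric_hypGrad (u : E3 → ℝ) (y w : E3) :
    hypMetric y (hypGrad u y) w = fderiv ℝ u y w := by
  have h : (0 : ℝ) < 1 + ‖y‖ ^ 2 := by positivity
  have hg : inner ℝ (gradient u y) w = fderiv ℝ u y w := by
    simp [gradient]
  simp only [hypMetric, hypGrad, inner_add_left, inner_add_right, inner_smul_left,
    inner_smul_right, real_inner_self_eq_norm_sq, hg]
  simp only [conj_trivial]
  field_simp
  ring

/-- The divergence for the hyperbolic metric, `(1/ρ) ∑ ∂ᵢ (ρ Xⁱ)`, where the volume density is
`ρ = 1 / √(1 + |y|²)`. -/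
def hypDiv (X : E3 → E3) (y : E3) : ℝ :=
  Real.sqrt (1 + ‖y‖ ^ 2) *
    ∑ i : Fin 3, fderiv ℝ (fun z : E3 => X z i / Real.sqrt (1 + ‖z‖ ^ 2)) y
      (EuclideanSpace.single i 1)

/-- The Laplacian `div ∘ grad` of hyperbolic 3-space. -/
def hypLaplacian (u : E3 → ℝ) : E3 → ℝ := hypDiv (hypGrad u)

/-- `f` is a positive smooth function on `N = ℍ³ / Γ` with `Δ f + lam f = 0`. Smoothness and the
Laplacian of `N` are read off on hyperbolic 3-space, as the quotient map is a local isometry. -/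
def IsPositiveEigenfunction (Γ : Subgroup IsomPlus) (lam : ℝ) (f : HypQuotient Γ → ℝ) : Prop :=
  (∀ p, 0 < f p) ∧
  ContDiff ℝ ∞ (fun y => f (proj Γ (graphParam y))) ∧
  ∀ y, hypLaplacian (fun z => f (proj Γ (graphParam z))) y
    + lam * f (proj Γ (graphParam y)) = 0

/-- `λ₀(N)`: the largest `lam` for which `N` carries a positive smooth solution of
`Δ f + lam f = 0`, taken as a supremum in the extended reals. -/
def lambdaZero (Γ : Subgroup IsomPlus) : EReal :=
  sSup (Real.toEReal '' {lam | ∃ f, IsPositiveEigenfunction Γ lam f})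

/-! ### Invariants of compact 3-manifolds -/

section

variable (M : Type*) [TopologicalSpace M] [ChartedSpace (EuclideanHalfSpace 3) M]

/-- The manifold interior of the 3-manifold with boundary `M`. -/
abbrev Interior : Type _ := (𝓡∂ 3).interior M

/-- `TT(M)`: the hyperbolic 3-manifolds `ℍ³ / Γ` homeomorphic to the interior of `M`, given by
their groups `Γ`. -/
def TT : Set (Subgroup IsomPlus) :=
  {Γ | IsTorsionFreeKleinian Γ ∧ Nonempty (HypQuotient Γ ≃ₜ Interior M)}

/-- `M` is orientable and hyperbolizable: its interior carries a complete hyperbolic structure, as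
the quotient of hyperbolic 3-space by a group of orientation-preserving isometries. -/
def OrientableHyperbolizable : Prop := (TT M).Nonempty

/-- `D(M)`, the infimum of `d(N)` over `N ∈ TT(M)`. -/
def invD : ℝ≥0∞ := ⨅ Γ ∈ TT M, hdim Γ

/-- `Λ(M)`, the supremum of `λ₀(N)` over `N ∈ TT(M)`. -/
def invLambda : EReal := ⨆ Γ ∈ TT M, lambdaZero Γ

end

/-- `X` covers `Y`. -/
def Covers (X Y : Type*) [TopologicalSpace X] [TopologicalSpace Y] : Prop :=
  ∃ p : X → Y, IsCoveringMap p ∧ Function.Surjective p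

end HypThree

end

/-!
A hyperbolic structure on the interior of `M` pulls back along the covering `Int M' → Int M`. If
`ℍ³/Γ ≃ₜ Int M`, then `ℍ³` is the universal cover of `Int M`, so the quotient map `ℍ³ → Int M`
lifts through the covering to a map `ℍ³ → Int M'`. This lift is a surjective local homeomorphism,
and by unique lifting its fibres are the orbits of the subgroup `Γ' ≤ Γ` of those elements which
leave the lift invariant (`exists_subgroup_homeomorph_of_isCoveringMap`). Hence
`ℍ³/Γ' ≃ₜ Int M'`, and `Γ'` belongs to `TT M'` (`exists_subgroup_mem_TT_of_covers`).

Both invariants are monotone under passing to a subgroup. A group acts discontinuously wherever a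
larger group does, so `limitSet Γ' ⊆ limitSet Γ` and the Hausdorff dimension does not increase
(`hdim_mono`). A positive solution of `Δ f + lam f = 0` on `ℍ³/Γ` pulls back to one on `ℍ³/Γ'`, so
`λ₀` does not decrease (`lambdaZero_anti`). Thus every member of `TT M` is dominated by a member
of `TT M'`, which gives both inequalities.
-/

open Topology

namespace HypThree

/-! ### Intermediate coverings of quotients of simply connected spaces -/

/-- The Galois correspondence for a universal covering given as a quotient by a group action: a
path connected covering space of `E / Γ`, with `E` simply connected, is `E / Γ'` for a subgroup
`Γ'` of `Γ`. -/
theorem exists_subgroup_homeomorph_of_isCoveringMap {G E X Y : Type*} [Group G]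
    [TopologicalSpace E] [SimplyConnectedSpace E] [LocallyPathConnectedSpace E] [MulAction G E]
    [TopologicalSpace X] [PathConnectedSpace X] [TopologicalSpace Y]
    (Γ : Subgroup G) {π : E → Y} (hπ : IsQuotientCoveringMap π Γ)
    {q : X → Y} (hq : IsCoveringMap q) :
    ∃ Γ' ≤ Γ, Nonempty (MulAction.orbitRel.Quotient Γ' E ≃ₜ X) := by
  have hcont : ContinuousConstSMul Γ E := hπ.toContinuousConstSMul
  obtain ⟨x₀⟩ := (inferInstance : Nonempty X)
  obtain ⟨a₀, ha₀⟩ := hπ.surjective (q x₀)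
  obtain ⟨F, ⟨hF0, hF⟩, -⟩ :=
    hq.existsUnique_continuousMap_lifts ⟨π, hπ.continuous⟩ a₀ x₀ ha₀.symm
  have hF' : ∀ e, q (F e) = π e := fun e => congrFun hF e
  have hopen : IsOpenMap F := by
    have h : IsLocalHomeomorph (q ∘ F) := by
      rw [hF]
      exact hπ.isCoveringMap.isLocalHomeomorph
    exact (h.of_comp hq.isLocalHomeomorph F.continuous).isOpenMap
  have hsurj : Function.Surjective F := by
    intro x
    -- A path from `x₀` to `x`, pushed down to `Y` and lifted to `E`, ends in the fibre over `x`.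
    let c : Path x₀ x := PathConnectedSpace.somePath x₀ x
    obtain ⟨d, hd, hd0⟩ := hπ.isCoveringMap.exists_path_lifts
      (ContinuousMap.comp ⟨q, hq.continuous⟩ c.toContinuousMap) a₀ (by simpa using ha₀.symm)
    have heq : (F ∘ d : unitInterval → X) = c :=
      hq.eq_of_comp_eq (F.continuous.comp d.continuous) c.continuous
        (by
          funext t
          exact (hF' (d t)).trans (congrFun hd t)) 0 (by simp [hd0, hF0])
    exact ⟨d 1, by simpa using congrFun heq 1⟩
  let Γ' : Subgroup G :=
    { carrier := {g | g ∈ Γ ∧ ∀ e, F (g • e) = F e}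
      one_mem' := ⟨Γ.one_mem, fun e => by rw [one_smul]⟩
      mul_mem' := fun {a b} ha hb =>
        ⟨Γ.mul_mem ha.1 hb.1, fun e => by rw [mul_smul, ha.2, hb.2]⟩
      inv_mem' := fun {a} ha =>
        ⟨Γ.inv_mem ha.1, fun e => by rw [← ha.2 (a⁻¹ • e), smul_inv_smul]⟩ }
  -- The fibres of the lift are the orbits of `Γ'`.
  have hfib : ∀ a b : E, F a = F b ↔ a ∈ MulAction.orbit Γ' b := by
    intro a b
    constructor
    · intro h
      obtain ⟨g, hg⟩ := hπ.apply_eq_iff_mem_orbit.mp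
        (show π a = π b by rw [← hF', ← hF', h])
      have hg : g • b = a := hg
      -- `F ∘ g` and `F` lift the same map and agree at `b`.
      have heq : (fun e => F (g • e)) = F :=
        hq.eq_of_comp_eq (F.continuous.comp (continuous_const_smul g)) F.continuous
          (by
            funext e
            exact ((hF' _).trans (hπ.map_smul g)).trans (hF' e).symm) b (by rw [hg, h])
      exact ⟨⟨g.1, g.2, fun e => congrFun heq e⟩, hg⟩
    · rintro ⟨g, rfl⟩
      exact g.2.2 b
  refine ⟨Γ', fun g hg => hg.1, ⟨Equiv.toHomeomorphOfContinuousOpen (Equiv.ofBijective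
    (Quotient.lift F fun a b h => (hfib a b).mpr h) ⟨?_, ?_⟩) ?_ ?_⟩⟩
  · rintro ⟨a⟩ ⟨b⟩ h
    exact Quotient.sound ((hfib a b).mp h)
  · intro x
    obtain ⟨a, rfl⟩ := hsurj x
    exact ⟨Quotient.mk _ a, rfl⟩
  · exact F.continuous.quotient_lift _
  · intro U hU
    have : (Quotient.lift F fun a b h => (hfib a b).mpr h) '' U = F '' (Quotient.mk _ ⁻¹' U) := by
      ext x
      constructor
      · rintro ⟨⟨a⟩, ha, rfl⟩
        exact ⟨a, ha, rfl⟩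
      · rintro ⟨a, ha, rfl⟩
        exact ⟨_, ha, rfl⟩
    change IsOpen ((Quotient.lift F fun a b h => (hfib a b).mpr h) '' U)
    rw [this]
    exact hopen _ (hU.preimage continuous_quotient_mk')

/-! ### Topology of hyperbolic 3-space -/

/-- The projection of the hyperboloid to its space coordinates is a homeomorphism, with inverse
`graphParam`. -/
noncomputable def sheetHomeomorph : Hyp3 ≃ₜ E3 where
  toFun x := x.1.2
  invFun := graphParam
  left_inv := by
    rintro ⟨⟨t, y⟩, h1, h2⟩
    have h2 : 0 < t := h2
    have h3 : 1 + ‖y‖ ^ 2 = t ^ 2 := by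
      simp only [lorentz] at h1
      linarith
    simp [graphParam, h3, Real.sqrt_sq h2.le]
  right_inv _ := rfl
  continuous_toFun := by fun_prop
  continuous_invFun := by
    unfold graphParam
    fun_prop

instance : ContractibleSpace Hyp3 := sheetHomeomorph.contractibleSpace

instance : LocallyPathConnectedSpace Hyp3 := sheetHomeomorph.isOpenEmbedding.locallyPathConnectedSpace

instance : LocallyCompactSpace Hyp3 := sheetHomeomorph.isClosedEmbedding.locallyCompactSpace

instance : ContinuousConstSMul IsomPlus Hyp3 where
  continuous_const_smul g :=
    ((LinearMap.continuous_of_finiteDimensional (g.1 : Mink →ₗ[ℝ] Mink)).comp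
      continuous_subtype_val).subtype_mk _

theorem IsTorsionFreeKleinian.isQuotientCoveringMap {Γ : Subgroup IsomPlus}
    (h : IsTorsionFreeKleinian Γ) : IsQuotientCoveringMap (proj Γ) Γ := by
  have : IsCancelSMul Γ Hyp3 := ⟨fun a b x hx => by
    have h1 := h.free (b⁻¹ * a) (Γ.mul_mem (Γ.inv_mem b.2) a.2) x (by
      rw [mul_smul]
      exact inv_smul_eq_iff.mpr hx)
    exact Subtype.ext (inv_mul_eq_one.mp h1).symm⟩
  have : ProperlyDiscontinuousSMul Γ Hyp3 := ⟨fun {K L} hK hL => by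
    have h1 := h.properlyDiscontinuous (K ∪ L) (hK.union hL)
    refine Set.Finite.of_finite_image (f := Subtype.val) (h1.subset ?_)
      Subtype.val_injective.injOn
    rintro _ ⟨g, hg, rfl⟩
    obtain ⟨_, ⟨x, hx, rfl⟩, hxL⟩ := hg
    exact ⟨g.2, g.1 • x, ⟨x, Or.inl hx, rfl⟩, Or.inr hxL⟩⟩
  have : ContinuousConstSMul Γ Hyp3 := ⟨fun g => continuous_const_smul g.1⟩
  exact isQuotientCoveringMap_quotientMk_of_properlyDiscontinuousSMul

/-! ### Passing to a subgroup -/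

section

variable {Γ' Γ : Subgroup IsomPlus}

theorem IsTorsionFreeKleinian.mono (h : IsTorsionFreeKleinian Γ) (hle : Γ' ≤ Γ) :
    IsTorsionFreeKleinian Γ' where
  free γ hγ := h.free γ (hle hγ)
  properlyDiscontinuous K hK :=
    (h.properlyDiscontinuous K hK).subset fun _ hγ => ⟨hle hγ.1, hγ.2⟩

theorem ActsDiscontinuouslyOn.mono {U : Set SphereInf} (h : ActsDiscontinuouslyOn Γ U)
    (hle : Γ' ≤ Γ) : ActsDiscontinuouslyOn Γ' U := fun ξ hξ =>
  let ⟨V, hV, hfin⟩ := h ξ hξ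
  ⟨V, hV, hfin.subset fun _ hγ => ⟨hle hγ.1, hγ.2⟩⟩

theorem limitSet_mono (hle : Γ' ≤ Γ) : limitSet Γ' ⊆ limitSet Γ :=
  Set.compl_subset_compl.mpr <| Set.sUnion_subset_sUnion fun _ hU => ⟨hU.1, hU.2.mono hle⟩

theorem hdim_mono (hle : Γ' ≤ Γ) : hdim Γ' ≤ hdim Γ := dimH_mono (limitSet_mono hle)

/-- The covering map `ℍ³ / Γ' → ℍ³ / Γ` for a subgroup `Γ'` of `Γ`. -/
def quotientMapOfLE (hle : Γ' ≤ Γ) : HypQuotient Γ' → HypQuotient Γ :=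
  Quotient.lift (proj Γ) fun _ _ ⟨g, hg⟩ => Quotient.sound ⟨⟨g.1, hle g.2⟩, hg⟩

theorem lambdaZero_anti (hle : Γ' ≤ Γ) : lambdaZero Γ ≤ lambdaZero Γ' := by
  refine sSup_le_sSup (Set.image_mono ?_)
  rintro lam ⟨f, hpos, hsmooth, heq⟩
  -- `f` and its pullback have the same lift to `ℍ³`.
  exact ⟨f ∘ quotientMapOfLE hle, fun _ => hpos _, hsmooth, heq⟩

end

/-! ### Coverings of interiors -/

theorem exists_subgroup_mem_TT_of_covers
    {M : Type*} [TopologicalSpace M] [ChartedSpace (EuclideanHalfSpace 3) M]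
    {M' : Type*} [TopologicalSpace M'] [ChartedSpace (EuclideanHalfSpace 3) M']
    (hM' : OrientableHyperbolizable M') (hcov : Covers (Interior M') (Interior M))
    {Γ : Subgroup IsomPlus} (hΓ : Γ ∈ TT M) : ∃ Γ' ∈ TT M', Γ' ≤ Γ := by
  obtain ⟨hK, ⟨e⟩⟩ := hΓ
  obtain ⟨_, -, ⟨e'⟩⟩ := hM'
  obtain ⟨p, hp, -⟩ := hcov
  have : PathConnectedSpace (Interior M') :=
    e'.surjective.pathConnectedSpace e'.continuous
  obtain ⟨Γ', hle, hhomeo⟩ := exists_subgroup_homeomorph_of_isCoveringMap Γ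
    (hK.isQuotientCoveringMap.homeomorph_comp e) hp
  exact ⟨Γ', ⟨hK.mono hle, hhomeo⟩, hle⟩

end HypThree

open HypThree in
theorem proposition2p6
    (M : Type*) [TopologicalSpace M] [T2Space M] [CompactSpace M]
    [ChartedSpace (EuclideanHalfSpace 3) M]
    (M' : Type*) [TopologicalSpace M'] [T2Space M'] [CompactSpace M']
    [ChartedSpace (EuclideanHalfSpace 3) M']
    (hM : OrientableHyperbolizable M) (hM' : OrientableHyperbolizable M')
    (hcov : Covers (Interior M') (Interior M)) :
    invD M ≥ invD M' ∧ invLambda M ≤ invLambda M' := by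
  constructor
  · refine le_iInf₂ fun Γ hΓ => ?_
    obtain ⟨Γ', hΓ', hle⟩ := exists_subgroup_mem_TT_of_covers hM' hcov hΓ
    exact iInf₂_le_of_le Γ' hΓ' (hdim_mono hle)
  · refine iSup₂_le fun Γ hΓ => ?_
    obtain ⟨Γ', hΓ', hle⟩ := exists_subgroup_mem_TT_of_covers hM' hcov hΓ
    exact le_iSup₂_of_le Γ' hΓ' (lambdaZero_anti hle)
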